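/- Let $(\Lambda,\mathcal E)$ be a finite simple connected graph with graph distance $d$, and let $u\in[-1,1]$, $\beta\ge 0$. On $\mathcal H_\Lambda=\bigotimes_{x\in\Lambda}\mathbb C^2$ consider the Hamiltonian \[ H_\Lambda^{(u)}=-2\sum_{\{x,y\}\in\mathcal E}\bigl(S_x^1S_y^1+u\,S_x^2S_y^2+S_x^3S_y^3\bigr),\qquad S_x^i=S^i\otimes \mathrm{Id}_{\Lambda\setminus\{x\}}, \] where $S^i=\tfrac12\sigma^i$ are the spin-$\tfrac12$ operators ($\sigma^1,\sigma^2,\sigma^3$ the Pauli matrices), and the Gibbs state \[ \langle A\rangle=\frac{\operatorname{Tr}\bigl(A\,e^{-\beta H_\Lambda^{(u)}}\bigr)}{\operatorname{Tr}e^{-\beta H_\Lambda^{(u)}}}. \] For every $C\in\mathbb R$ and every $\beta\ge0$ there is a constant $K$, depending only on $C$ and $\beta$ (and not on $(\Lambda,\mathcal E)$ or $u$), such that the following holds. If \[ \#\{y\in\Lambda: d(x,y)=k\}\le Ck\qquad\text{for all }x\in\Lambda\text{ and all integers }k\ge1, \] then for all $x,y\in\Lambda$ the correlation $\langle S_x^3S_y^3\rangle$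 is real and satisfies $\langle S_x^3S_y^3\rangle\ge0$, and whenever $d(x,y)\ge2$, \[ \langle S_x^3S_y^3\rangle\le\frac{K}{\sqrt{\log d(x,y)}}. \] -/

import Mathlib

noncomputable section

namespace Heisenberg

/-- The Pauli matrices, `pauli 0`, `pauli 1`, `pauli 2` being `σ¹`, `σ²`, `σ³`. -/
def pauli : Fin 3 → Matrix (Fin 2) (Fin 2) ℂ :=
  ![!![0, 1; 1, 0], !![0, -Complex.I; Complex.I, 0], !![1, 0; 0, -1]]

/-- The spin-1/2 operators on `ℂ²`: `spin 0`, `spin 1`, `spin 2` are `S¹`, `S²`, `S³`. -/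
def spin (i : Fin 3) : Matrix (Fin 2) (Fin 2) ℂ := (1 / 2 : ℂ) • pauli i

variable {Λ : Type*} [Fintype Λ] [DecidableEq Λ]

/-- Operators on `⊗_{x ∈ Λ} ℂ²`, written as matrices in the product basis, which is indexed by the
spin configurations `Λ → Fin 2`. -/
abbrev Op (Λ : Type*) : Type _ := Matrix (Λ → Fin 2) (Λ → Fin 2) ℂ

/-- The matrix of the tensor product `⊗_{z ∈ Λ} A_z` in the product basis. -/
def tensorOp (A : Λ → Matrix (Fin 2) (Fin 2) ℂ) : Op Λ :=
  Matrix.of fun σ τ => ∏ z, A z (σ z) (τ z)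

/-- `A ⊗ Id_{Λ ∖ {x}}`: the one-site operator `A` acting at the site `x`. -/
def siteOp (x : Λ) (A : Matrix (Fin 2) (Fin 2) ℂ) : Op Λ :=
  tensorOp (Function.update (fun _ => 1) x A)

/-- The spin operator at the site `x`. -/
def spinAt (i : Fin 3) (x : Λ) : Op Λ := siteOp x (spin i)

theorem tensorOp_mul (A B : Λ → Matrix (Fin 2) (Fin 2) ℂ) :
    tensorOp A * tensorOp B = tensorOp (fun z => A z * B z) := by
  ext σ τ
  simp only [tensorOp, Matrix.mul_apply, Matrix.of_apply, ← Finset.prod_mul_distrib]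
  exact (Fintype.prod_sum fun z j => A z (σ z) j * B z j (τ z)).symm

theorem spinAt_comm (i : Fin 3) (x y : Λ) :
    spinAt i x * spinAt i y = spinAt i y * spinAt i x := by
  simp only [spinAt, siteOp, tensorOp_mul]
  congr 1
  funext z
  by_cases hx : z = x <;> by_cases hy : z = y <;> simp [Function.update_apply, hx, hy]

/-- The interaction `S¹_x S¹_y + u S²_x S²_y + S³_x S³_y`. -/
def bond (u : ℝ) (x y : Λ) : Op Λ :=
  spinAt 0 x * spinAt 0 y + (u : ℂ) • (spinAt 1 x * spinAt 1 y) + spinAt 2 x * spinAt 2 y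

theorem bond_comm (u : ℝ) (x y : Λ) : bond u x y = bond u y x := by
  simp only [bond, spinAt_comm _ x y]

/-- The interaction attached to an unordered pair of sites. -/
def edgeBond (u : ℝ) : Sym2 Λ → Op Λ :=
  Sym2.lift ⟨fun x y => bond u x y, bond_comm u⟩

variable (G : SimpleGraph Λ) [DecidableRel G.Adj]

/-- The Hamiltonian `-2 ∑_{{x,y} ∈ E} (S¹_x S¹_y + u S²_x S²_y + S³_x S³_y)`. -/
def hamiltonian (u : ℝ) : Op Λ := (-2 : ℂ) • ∑ e ∈ G.edgeFinset, edgeBond u e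

/-- The Boltzmann operator `exp (-β H)`. -/
def boltzmann (u β : ℝ) : Op Λ := NormedSpace.exp ((-β : ℂ) • hamiltonian G u)

/-- The partition function `Tr exp (-β H)`. -/
def partitionFunction (u β : ℝ) : ℂ := (boltzmann G u β).trace

/-- The expectation of `A` in the Gibbs state, `Tr (A exp (-β H)) / Tr exp (-β H)`. -/
def gibbs (u β : ℝ) (A : Op Λ) : ℂ := (A * boltzmann G u β).trace / partitionFunction G u β

end Heisenberg

end

/-! This is a Mermin–Wagner argument: the model is invariant under rotations about the second axis,
and in at most quadratic growth a slowly varying rotation costs little energy.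

Upper bound: `IsHermitian.bogoliubov` is applied with generator `∑ θ_z S²_z` and observable `S¹_x
S³_y`. If `θ x = 1` and `θ y = 0`, their commutator is `-i S³_x S³_y`. The double commutator with
the Hamiltonian involves only squared increments of `θ` along edges and does not see `u`. Hence
`sq_gibbs_spinAt_two_le`: the squared correlation is at most `β / 16` times the Dirichlet energy of
`θ`. A radial logarithmic profile has increments of order `1 / (k log d)` at distance `k`; with at
most `C k` sites there and degrees at most `C`, a harmonic sum gives energy `O(1 / log d)`
(`sum_sqIncrement_logProfile_le`).

Positivity: a Hadamard rotation fixes the Hamiltonian and turns `S³_x S³_y` into `S¹_x S¹_y`. For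
`|u| ≤ 1` both this operator and the Boltzmann operator have nonnegative entries in the product
basis. -/

noncomputable section

/-! ### Matrix exponentials: entrywise positivity and Gibbs traces -/

namespace Matrix

open scoped ComplexOrder

variable {n : Type*} [Fintype n] [DecidableEq n]

/-- The entries of the exponential of an entrywise nonnegative matrix are nonnegative. -/
theorem exp_apply_nonneg {M : Matrix n n ℂ} (hM : ∀ i j, 0 ≤ M i j) (i j : n) :
    0 ≤ NormedSpace.exp M i j := by
  let : NormedRing (Matrix n n ℂ) := Matrix.linftyOpNormedRing
  let : NormedAlgebra ℂ (Matrix n n ℂ) := Matrix.linftyOpNormedAlgebra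
  have hpow : ∀ k : ℕ, ∀ i j, 0 ≤ (M ^ k) i j := by
    intro k
    induction k with
    | zero =>
      intro i j
      rw [pow_zero, one_apply]
      split_ifs <;> simp
    | succ k ih =>
      intro i j
      rw [pow_succ, mul_apply]
      exact Finset.sum_nonneg fun l _ => mul_nonneg (ih i l) (hM l j)
  have hs := NormedSpace.exp_series_hasSum_exp' (𝕂 := ℂ) M
  have hs' := hs.map ((Pi.evalAddMonoidHom (fun _ : n => ℂ) j).comp
    (Pi.evalAddMonoidHom (fun _ : n => n → ℂ) i)) (by
      exact (continuous_apply j).comp (continuous_apply i))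
  refine hs'.nonneg fun k => ?_
  have : (0 : ℂ) ≤ ((k.factorial : ℂ))⁻¹ := by
    rw [inv_nonneg]; exact_mod_cast Nat.zero_le _
  exact mul_nonneg this (hpow k i j)

/-- The same with an arbitrary real multiple of the identity added. -/
theorem exp_apply_nonneg_of_add_smul_one {M : Matrix n n ℂ} (c : ℝ)
    (hM : ∀ i j, 0 ≤ (M + (c : ℂ) • (1 : Matrix n n ℂ)) i j) (i j : n) :
    0 ≤ NormedSpace.exp M i j := by
  have h1 : M = (M + (c : ℂ) • (1 : Matrix n n ℂ)) + diagonal (fun _ => ((-c : ℝ) : ℂ)) := by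
    ext a b
    by_cases hab : a = b <;> simp [hab]
  have hcomm : Commute (M + (c : ℂ) • (1 : Matrix n n ℂ)) (diagonal (fun _ => ((-c : ℝ) : ℂ))) := by
    have : (diagonal (fun _ => ((-c : ℝ) : ℂ)) : Matrix n n ℂ) = scalar n ((-c : ℝ) : ℂ) := rfl
    rw [this]
    exact (scalar_commute _ (fun _ => Commute.all _ _) _).symm
  rw [h1, exp_add_of_commute _ _ hcomm, exp_diagonal, mul_diagonal]
  refine mul_nonneg (exp_apply_nonneg hM i j) ?_
  rw [Pi.coe_exp, ← Complex.exp_eq_exp_ℂ, ← Complex.ofReal_exp]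
  exact_mod_cast (Real.exp_pos _).le

theorem exp_half_mul_self (M : Matrix n n ℂ) :
    NormedSpace.exp ((1 / 2 : ℝ) • M) * NormedSpace.exp ((1 / 2 : ℝ) • M) = NormedSpace.exp M := by
  rw [← exp_add_of_commute _ _ (Commute.refl _), ← add_smul]
  norm_num

/-- With `E = exp (M / 2)` Hermitian, cyclicity turns the trace into that of `(B E)ᴴ (B E)`. -/
theorem IsHermitian.trace_conjTranspose_mul_self_mul_exp_nonneg {M : Matrix n n ℂ}
    (hM : M.IsHermitian) (B : Matrix n n ℂ) : 0 ≤ (Bᴴ * B * NormedSpace.exp M).trace := by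
  have hE : ((1 / 2 : ℝ) • M).IsHermitian := hM.smul (IsSelfAdjoint.all _)
  set E := NormedSpace.exp ((1 / 2 : ℝ) • M) with hEdef
  have hE' : Eᴴ = E := hE.exp
  have : (Bᴴ * B * NormedSpace.exp M).trace = ((B * E)ᴴ * (B * E)).trace := by
    rw [← exp_half_mul_self, ← hEdef, conjTranspose_mul, hE', ← mul_assoc, trace_mul_comm]
    simp only [mul_assoc]
  rw [this]
  exact (posSemidef_conjTranspose_mul_self _).trace_nonneg

theorem IsHermitian.trace_exp_pos [Nonempty n] {M : Matrix n n ℂ} (hM : M.IsHermitian) :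
    0 < (NormedSpace.exp M).trace := by
  have h0 := hM.trace_conjTranspose_mul_self_mul_exp_nonneg 1
  simp only [conjTranspose_one, mul_one, one_mul] at h0
  refine lt_of_le_of_ne h0 fun h => ?_
  have hE : ((1 / 2 : ℝ) • M).IsHermitian := hM.smul (IsSelfAdjoint.all _)
  have hE' : (NormedSpace.exp ((1 / 2 : ℝ) • M))ᴴ = NormedSpace.exp ((1 / 2 : ℝ) • M) := hE.exp
  have h1 := exp_half_mul_self M
  rw [← h1] at h
  nth_rewrite 1 [← hE'] at h
  have h2 := trace_conjTranspose_mul_self_eq_zero_iff.1 h.symm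
  exact (isUnit_exp ((1 / 2 : ℝ) • M)).ne_zero h2

/-- An involution has expectation at most one in a Gibbs state. -/
theorem IsHermitian.trace_mul_exp_re_le {M P : Matrix n n ℂ} (hM : M.IsHermitian)
    (hP : P.IsHermitian) (hPP : P * P = 1) :
    (P * NormedSpace.exp M).trace.re ≤ (NormedSpace.exp M).trace.re := by
  -- For an involution, `1 - P` is half its own square, so positivity of the state applies to it.
  have h := hM.trace_conjTranspose_mul_self_mul_exp_nonneg (1 - P)
  have h2 : (1 - P)ᴴ * (1 - P) = (2 : ℂ) • (1 - P) := by
    rw [conjTranspose_sub, conjTranspose_one, hP.eq, mul_sub, sub_mul, sub_mul, hPP, two_smul]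
    simp only [mul_one, one_mul]
    abel
  rw [h2, smul_mul, trace_smul, sub_mul, one_mul, trace_sub] at h
  have := (Complex.le_def.1 h).1
  simp at this
  linarith

end Matrix

/-! ### Scalar inequalities and the Bogoliubov inequality -/

theorem Real.sinh_le_mul_cosh {t : ℝ} (ht : 0 ≤ t) : Real.sinh t ≤ t * Real.cosh t := by
  have hmono : MonotoneOn (fun s : ℝ => s * Real.cosh s - Real.sinh s) (Set.Ici 0) := by
    refine monotoneOn_of_deriv_nonneg (convex_Ici 0) (by fun_prop) (by fun_prop) fun s hs => ?_
    rw [interior_Ici] at hs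
    have hd : HasDerivAt (fun s : ℝ => s * Real.cosh s - Real.sinh s)
        (1 * Real.cosh s + s * Real.sinh s - Real.cosh s) s :=
      ((hasDerivAt_id s).mul (Real.hasDerivAt_cosh s)).sub (Real.hasDerivAt_sinh s)
    rw [hd.deriv]
    have : 0 ≤ s * Real.sinh s := mul_nonneg (le_of_lt hs) (Real.sinh_nonneg_iff.2 (le_of_lt hs))
    linarith
  have := hmono (Set.mem_Ici.2 le_rfl) (Set.mem_Ici.2 ht) ht
  simp at this
  linarith

/-- The logarithmic mean is at most the arithmetic mean: dividing by `exp ((a + b) / 2)` leaves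
`sinh t ≤ t cosh t` at `t = (a - b) / 2`. -/
theorem Real.exp_sub_exp_le {a b : ℝ} (h : b ≤ a) :
    Real.exp a - Real.exp b ≤ (a - b) * ((Real.exp a + Real.exp b) / 2) := by
  have h1 := Real.sinh_le_mul_cosh (t := (a - b) / 2) (by linarith)
  have ha : Real.exp a = Real.exp ((a + b) / 2) * Real.exp ((a - b) / 2) := by
    rw [← Real.exp_add]; ring_nf
  have hb : Real.exp b = Real.exp ((a + b) / 2) * Real.exp (-((a - b) / 2)) := by
    rw [← Real.exp_add]; ring_nf
  rw [Real.sinh_eq, Real.cosh_eq] at h1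
  rw [ha, hb]
  have := mul_le_mul_of_nonneg_left h1 (Real.exp_pos ((a + b) / 2)).le
  linarith

theorem Real.exp_sub_exp_mul_sub_nonneg (a b : ℝ) : 0 ≤ (Real.exp a - Real.exp b) * (a - b) := by
  rcases le_total b a with h | h
  · exact mul_nonneg (sub_nonneg.2 (Real.exp_le_exp.2 h)) (sub_nonneg.2 h)
  · exact mul_nonneg_of_nonpos_of_nonpos (sub_nonpos.2 (Real.exp_le_exp.2 h)) (sub_nonpos.2 h)

theorem Real.sq_exp_sub_exp_le (a b : ℝ) :
    (Real.exp a - Real.exp b) ^ 2 ≤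
      (Real.exp a - Real.exp b) * (a - b) * ((Real.exp a + Real.exp b) / 2) := by
  wlog h : b ≤ a generalizing a b
  · have := this b a (le_of_not_ge h)
    calc _ = (Real.exp b - Real.exp a) ^ 2 := by ring
      _ ≤ _ := this
      _ = _ := by ring
  rw [sq, mul_assoc]
  exact mul_le_mul_of_nonneg_left (Real.exp_sub_exp_le h) (sub_nonneg.2 (Real.exp_le_exp.2 h))

namespace Matrix

variable {n : Type*} [Fintype n] [DecidableEq n]

theorem trace_mul_mul_diagonal (A B : Matrix n n ℂ) (w : n → ℂ) :
    (A * B * diagonal w).trace = ∑ i, ∑ j, A i j * B j i * w i := by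
  simp only [trace, diag_apply, mul_diagonal]
  exact Finset.sum_congr rfl fun i _ => by rw [mul_apply, Finset.sum_mul]

/-- The Bogoliubov inequality for a diagonal generator. -/
theorem bogoliubov_diagonal (E : n → ℝ) (C A : Matrix n n ℂ) :
    ‖((C * A - A * C) * diagonal fun i => (Real.exp (E i) : ℂ)).trace‖ ^ 2 ≤
      1 / 2 * ((Aᴴ * A + A * Aᴴ) * diagonal fun i => (Real.exp (E i) : ℂ)).trace.re *
        ((Cᴴ * (C * diagonal (fun i => (E i : ℂ)) - diagonal (fun i => (E i : ℂ)) * C) -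
          (C * diagonal (fun i => (E i : ℂ)) - diagonal (fun i => (E i : ℂ)) * C) * Cᴴ) *
            diagonal fun i => (Real.exp (E i) : ℂ)).trace.re := by
  set w : n → ℝ := fun i => Real.exp (E i) with hw
  have hns : ∀ z : ℂ, (starRingEnd ℂ) z * z = ((‖z‖ ^ 2 : ℝ) : ℂ) := fun z => by
    rw [Complex.conj_mul']; push_cast; rfl
  have hns' : ∀ z : ℂ, z * (starRingEnd ℂ) z = ((‖z‖ ^ 2 : ℝ) : ℂ) := fun z => by
    rw [mul_comm, hns]
  have e1 : ((C * A - A * C) * diagonal fun i => (w i : ℂ)).trace =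
      ∑ i, ∑ j, C i j * A j i * (w i - w j : ℝ) := by
    simp only [sub_mul, trace_sub]
    have : (A * C * diagonal fun i => (w i : ℂ)).trace = ∑ i, ∑ j, C i j * A j i * (w j : ℝ) := by
      simp only [trace_mul_mul_diagonal]
      rw [Finset.sum_comm]
      exact Finset.sum_congr rfl fun i _ => Finset.sum_congr rfl fun j _ => by ring
    rw [this]
    simp only [trace_mul_mul_diagonal, ← Finset.sum_sub_distrib]
    exact Finset.sum_congr rfl fun i _ => Finset.sum_congr rfl fun j _ => by push_cast; ring
  have e2 : ((Aᴴ * A + A * Aᴴ) * diagonal fun i => (w i : ℂ)).trace =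
      ((∑ i, ∑ j, ‖A j i‖ ^ 2 * (w i + w j) : ℝ) : ℂ) := by
    simp only [add_mul, trace_add]
    have : (A * Aᴴ * diagonal fun i => (w i : ℂ)).trace =
        ((∑ i, ∑ j, ‖A j i‖ ^ 2 * w j : ℝ) : ℂ) := by
      simp only [trace_mul_mul_diagonal, conjTranspose_apply,
        RCLike.star_def, hns', Complex.ofReal_sum, Complex.ofReal_mul]
      rw [Finset.sum_comm]
    rw [this]
    simp only [trace_mul_mul_diagonal, conjTranspose_apply,
        RCLike.star_def, hns, Complex.ofReal_sum, Complex.ofReal_mul, ← Finset.sum_add_distrib,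
        Complex.ofReal_add]
    exact Finset.sum_congr rfl fun i _ => Finset.sum_congr rfl fun j _ => by ring
  have e3 : ((Cᴴ * (C * diagonal (fun i => (E i : ℂ)) - diagonal (fun i => (E i : ℂ)) * C) -
      (C * diagonal (fun i => (E i : ℂ)) - diagonal (fun i => (E i : ℂ)) * C) * Cᴴ) *
        diagonal fun i => (w i : ℂ)).trace =
      ((∑ i, ∑ j, ‖C i j‖ ^ 2 * ((w i - w j) * (E i - E j)) : ℝ) : ℂ) := by
    set D := C * diagonal (fun i => (E i : ℂ)) - diagonal (fun i => (E i : ℂ)) * C with hD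
    have hDe : ∀ i j, D i j = C i j * (E j - E i : ℝ) := by
      intro i j
      rw [hD, sub_apply, mul_diagonal, diagonal_mul]; push_cast; ring
    simp only [sub_mul, trace_sub]
    have h1 : (Cᴴ * D * diagonal fun i => (w i : ℂ)).trace =
        ((∑ i, ∑ j, ‖C i j‖ ^ 2 * ((E j - E i) * w j) : ℝ) : ℂ) := by
      simp only [trace_mul_mul_diagonal, conjTranspose_apply,
        RCLike.star_def, hDe, ← mul_assoc, hns, Complex.ofReal_sum, Complex.ofReal_mul]
      rw [Finset.sum_comm]
    have h2 : (D * Cᴴ * diagonal fun i => (w i : ℂ)).trace =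
        ((∑ i, ∑ j, ‖C i j‖ ^ 2 * ((E j - E i) * w i) : ℝ) : ℂ) := by
      simp only [trace_mul_mul_diagonal, conjTranspose_apply,
        RCLike.star_def, hDe, Complex.ofReal_sum, Complex.ofReal_mul, ← hns']
      exact Finset.sum_congr rfl fun i _ => Finset.sum_congr rfl fun j _ => by ring
    rw [h1, h2, ← Complex.ofReal_sub, ← Finset.sum_sub_distrib]
    congr 1
    refine Finset.sum_congr rfl fun i _ => ?_
    rw [← Finset.sum_sub_distrib]
    exact Finset.sum_congr rfl fun j _ => by ring
  rw [e1, e2, e3, Complex.ofReal_re, Complex.ofReal_re]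
  have hnorm : ‖∑ i, ∑ j, C i j * A j i * ((w i - w j : ℝ) : ℂ)‖ ≤
      ∑ p : n × n, ‖C p.1 p.2‖ * ‖A p.2 p.1‖ * |w p.1 - w p.2| := by
    rw [← Fintype.sum_prod_type' (f := fun i j => C i j * A j i * ((w i - w j : ℝ) : ℂ))]
    refine (norm_sum_le _ _).trans (le_of_eq (Finset.sum_congr rfl fun p _ => ?_))
    rw [norm_mul, norm_mul, Complex.norm_real, Real.norm_eq_abs]
  -- Cauchy–Schwarz over pairs of eigenvalues; `Real.sq_exp_sub_exp_le` splits `(w i - w j) ^ 2`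
  -- into the weights of the two factors.
  have hcs := Finset.sum_sq_le_sum_mul_sum_of_sq_le_mul (Finset.univ : Finset (n × n))
    (r := fun p => ‖C p.1 p.2‖ * ‖A p.2 p.1‖ * |w p.1 - w p.2|)
    (f := fun p => ‖A p.2 p.1‖ ^ 2 * (w p.1 + w p.2))
    (g := fun p => 1 / 2 * (‖C p.1 p.2‖ ^ 2 * ((w p.1 - w p.2) * (E p.1 - E p.2))))
    (fun p _ => mul_nonneg (sq_nonneg _) (add_pos (Real.exp_pos _) (Real.exp_pos _)).le)
    (fun p _ => mul_nonneg (by norm_num) (mul_nonneg (sq_nonneg _)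
      (Real.exp_sub_exp_mul_sub_nonneg _ _)))
    (fun p _ => by
      rw [mul_pow, mul_pow, sq_abs]
      have := mul_le_mul_of_nonneg_left (Real.sq_exp_sub_exp_le (E p.1) (E p.2))
        (mul_nonneg (sq_nonneg ‖C p.1 p.2‖) (sq_nonneg ‖A p.2 p.1‖))
      refine this.trans (le_of_eq ?_)
      simp only [hw]
      ring)
  refine (pow_le_pow_left₀ (norm_nonneg _) hnorm 2).trans (hcs.trans (le_of_eq ?_))
  rw [← Finset.mul_sum, Fintype.sum_prod_type, Fintype.sum_prod_type]
  ring

/-- The Bogoliubov inequality for the weight `exp M`; for `M = -β H` the last factor is `β` times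
the double commutator `[C*, [H, C]]`. -/
theorem IsHermitian.bogoliubov {M : Matrix n n ℂ} (hM : M.IsHermitian) (C A : Matrix n n ℂ) :
    ‖((C * A - A * C) * NormedSpace.exp M).trace‖ ^ 2 ≤
      1 / 2 * ((Aᴴ * A + A * Aᴴ) * NormedSpace.exp M).trace.re *
        ((Cᴴ * (C * M - M * C) - (C * M - M * C) * Cᴴ) * NormedSpace.exp M).trace.re := by
  -- Unitary conjugation is a trace-preserving star automorphism, so everything transfers to the
  -- eigenbasis of `M`.
  obtain ⟨U, E, hUE⟩ : ∃ (U : unitaryGroup n ℂ) (E : n → ℝ),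
      M = Unitary.conjStarAlgAut ℂ (Matrix n n ℂ) U (diagonal fun i => (E i : ℂ)) :=
    ⟨_, _, hM.spectral_theorem⟩
  set φ := Unitary.conjStarAlgAut ℂ (Matrix n n ℂ) U with hφ
  have htr : ∀ X, (φ X).trace = X.trace := fun X => by
    rw [hφ, Unitary.conjStarAlgAut_apply, trace_mul_comm, ← mul_assoc]
    simp
  have hexpD : NormedSpace.exp (diagonal fun i => (E i : ℂ)) =
      diagonal fun i => (Real.exp (E i) : ℂ) := by
    rw [exp_diagonal]
    congr 1
    funext i
    rw [Pi.coe_exp, ← Complex.exp_eq_exp_ℂ, ← Complex.ofReal_exp]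
  have hexp : NormedSpace.exp M = φ (diagonal fun i => (Real.exp (E i) : ℂ)) := by
    rw [← hexpD, hUE, hφ, Unitary.conjStarAlgAut_apply, Unitary.conjStarAlgAut_apply]
    exact exp_units_conj (Unitary.toUnits U) _
  obtain ⟨C', rfl⟩ : ∃ C', φ C' = C := φ.surjective C
  obtain ⟨A', rfl⟩ : ∃ A', φ A' = A := φ.surjective A
  have hstar : ∀ X, (φ X)ᴴ = φ Xᴴ := fun X => (map_star φ X).symm
  rw [hexp, hUE]
  simp only [hstar, ← map_mul, ← map_sub, ← map_add, htr]
  exact bogoliubov_diagonal _ _ _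

end Matrix

end

noncomputable section

/-! ### Algebra of one-site operators and spins -/

namespace Heisenberg

open scoped ComplexOrder Matrix
open Matrix

theorem tensorOp_one {V : Type*} [Fintype V] : tensorOp (fun _ : V => 1) = 1 := by
  ext σ τ
  rw [tensorOp, of_apply, one_apply]
  split_ifs with h
  · subst h
    simp
  · obtain ⟨z, hz⟩ := Function.ne_iff.1 h
    exact Finset.prod_eq_zero (Finset.mem_univ z) (one_apply_ne hz)

theorem prod_one_apply_nonneg {V : Type*} (s : Finset V) (σ τ : V → Fin 2) :
    0 ≤ ∏ z ∈ s, (1 : Matrix (Fin 2) (Fin 2) ℂ) (σ z) (τ z) :=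
  Finset.prod_nonneg fun z _ => by
    rw [one_apply]
    split_ifs <;> simp

variable {Λ : Type*} [Fintype Λ] [DecidableEq Λ]

theorem siteOp_apply (x : Λ) (A : Matrix (Fin 2) (Fin 2) ℂ) (σ τ : Λ → Fin 2) :
    siteOp x A σ τ = A (σ x) (τ x) *
      ∏ z ∈ Finset.univ.erase x, (1 : Matrix (Fin 2) (Fin 2) ℂ) (σ z) (τ z) := by
  rw [siteOp, tensorOp, of_apply, ← Finset.mul_prod_erase _ _ (Finset.mem_univ x)]
  congr 1
  · simp
  · exact Finset.prod_congr rfl fun z hz => by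
      rw [Function.update_of_ne (Finset.ne_of_mem_erase hz)]

theorem siteOp_sub (x : Λ) (A B : Matrix (Fin 2) (Fin 2) ℂ) :
    siteOp x (A - B) = siteOp x A - siteOp x B := by
  ext σ τ
  simp only [siteOp_apply, Matrix.sub_apply, sub_mul]

theorem siteOp_smul (x : Λ) (c : ℂ) (A : Matrix (Fin 2) (Fin 2) ℂ) :
    siteOp x (c • A) = c • siteOp x A := by
  ext σ τ
  simp only [siteOp_apply, Matrix.smul_apply, smul_eq_mul, mul_assoc]

theorem siteOp_one (x : Λ) : siteOp x 1 = 1 := by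
  rw [siteOp, Function.update_eq_self_iff.2 rfl, tensorOp_one]

theorem siteOp_mul (x : Λ) (A B : Matrix (Fin 2) (Fin 2) ℂ) :
    siteOp x A * siteOp x B = siteOp x (A * B) := by
  rw [siteOp, siteOp, siteOp, tensorOp_mul]
  congr 1
  funext z
  by_cases hz : z = x
  · subst hz; simp
  · simp [Function.update_of_ne hz]

theorem siteOp_commute {x y : Λ} (h : x ≠ y) (A B : Matrix (Fin 2) (Fin 2) ℂ) :
    Commute (siteOp x A) (siteOp y B) := by
  rw [commute_iff_eq, siteOp, siteOp, tensorOp_mul, tensorOp_mul]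
  congr 1
  funext z
  by_cases hx : z = x
  · subst hx; simp [Function.update_of_ne h]
  · simp [Function.update_of_ne hx]

theorem siteOp_conjTranspose (x : Λ) (A : Matrix (Fin 2) (Fin 2) ℂ) :
    (siteOp x A)ᴴ = siteOp x Aᴴ := by
  ext σ τ
  rw [conjTranspose_apply, siteOp_apply, siteOp_apply, star_mul', conjTranspose_apply, star_prod]
  congr 1
  refine Finset.prod_congr rfl fun z _ => ?_
  rw [← conjTranspose_apply, conjTranspose_one]

theorem spin_zero_eq : spin 0 = !![0, 1 / 2; 1 / 2, 0] := by simp [spin, pauli]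

theorem spin_one_eq : spin 1 = !![0, -Complex.I / 2; Complex.I / 2, 0] := by
  simp [spin, pauli, div_eq_inv_mul]

theorem spin_two_eq : spin 2 = !![1 / 2, 0; 0, -1 / 2] := by
  ext a b
  fin_cases a <;> fin_cases b <;> simp [spin, pauli, div_eq_inv_mul]

theorem spin_isHermitian (i : Fin 3) : (spin i).IsHermitian := by
  ext a b
  fin_cases i <;> fin_cases a <;> fin_cases b <;> simp [spin, pauli]

theorem spin_mul_self (i : Fin 3) : spin i * spin i = (1 / 4 : ℂ) • 1 := by
  ext a b
  fin_cases i <;> fin_cases a <;> fin_cases b <;> norm_num [spin, pauli, Matrix.mul_apply, Fin.sum_univ_two] <;>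
    ring_nf <;> norm_num

theorem commutator_spin_one_zero : spin 1 * spin 0 - spin 0 * spin 1 = (-Complex.I) • spin 2 := by
  rw [spin_zero_eq, spin_one_eq, spin_two_eq]
  ext a b
  fin_cases a <;> fin_cases b <;> simp <;> ring

theorem commutator_spin_one_two : spin 1 * spin 2 - spin 2 * spin 1 = Complex.I • spin 0 := by
  rw [spin_zero_eq, spin_one_eq, spin_two_eq]
  ext a b
  fin_cases a <;> fin_cases b <;> simp <;> ring

theorem spinAt_isHermitian (i : Fin 3) (x : Λ) : (spinAt i x).IsHermitian := by
  rw [IsHermitian, spinAt, siteOp_conjTranspose, (spin_isHermitian i).eq]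

theorem spinAt_mul_self (i : Fin 3) (x : Λ) : spinAt i x * spinAt i x = (1 / 4 : ℂ) • 1 := by
  rw [spinAt, siteOp_mul, spin_mul_self, siteOp_smul, siteOp_one]

theorem spinAt_commute {x y : Λ} (h : x ≠ y) (i j : Fin 3) : Commute (spinAt i x) (spinAt j y) :=
  siteOp_commute h _ _

theorem spinAt_mul_spinAt_isHermitian {x y : Λ} (h : x ≠ y) (i j : Fin 3) :
    (spinAt i x * spinAt j y).IsHermitian := by
  rw [IsHermitian, conjTranspose_mul, (spinAt_isHermitian i x).eq, (spinAt_isHermitian j y).eq,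
    (spinAt_commute h i j).eq]

theorem spinAt_mul_spinAt_mul_self {x y : Λ} (h : x ≠ y) (i j : Fin 3) :
    spinAt i x * spinAt j y * (spinAt i x * spinAt j y) = (1 / 16 : ℂ) • 1 := by
  rw [(spinAt_commute h i j).symm.mul_mul_mul_comm, spinAt_mul_self, spinAt_mul_self, smul_mul_smul,
    one_mul]
  norm_num

theorem bond_isHermitian (u : ℝ) {x y : Λ} (h : x ≠ y) : (bond u x y).IsHermitian :=
  ((spinAt_mul_spinAt_isHermitian h 0 0).add
    ((spinAt_mul_spinAt_isHermitian h 1 1).smul (Complex.conj_ofReal u))).add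
    (spinAt_mul_spinAt_isHermitian h 2 2)

variable (G : SimpleGraph Λ) [DecidableRel G.Adj]

theorem neg_smul_hamiltonian (u β : ℝ) :
    (-β : ℂ) • hamiltonian G u = ((2 * β : ℝ) : ℂ) • ∑ e ∈ G.edgeFinset, edgeBond u e := by
  rw [hamiltonian, smul_smul]
  congr 1
  push_cast
  ring

theorem neg_smul_hamiltonian_isHermitian (u β : ℝ) :
    ((-β : ℂ) • hamiltonian G u).IsHermitian := by
  rw [neg_smul_hamiltonian]
  refine IsHermitian.smul ?_ (Complex.conj_ofReal _)
  rw [IsHermitian, conjTranspose_sum]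
  refine Finset.sum_congr rfl fun e he => ?_
  induction e with
  | _ x y => exact bond_isHermitian u (G.ne_of_adj (by simpa using he))

/-! ### Positivity of correlations -/

theorem spinAt_mul_spinAt_apply {x y : Λ} (h : x ≠ y) (i j : Fin 3) (σ τ : Λ → Fin 2) :
    (spinAt i x * spinAt j y) σ τ = spin i (σ x) (τ x) * spin j (σ y) (τ y) *
      ∏ z ∈ (Finset.univ.erase x).erase y, (1 : Matrix (Fin 2) (Fin 2) ℂ) (σ z) (τ z) := by
  have hy : y ∈ Finset.univ.erase x := Finset.mem_erase.2 ⟨h.symm, Finset.mem_univ y⟩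
  rw [spinAt, spinAt, siteOp, siteOp, tensorOp_mul, tensorOp, of_apply,
    ← Finset.mul_prod_erase _ _ (Finset.mem_univ x), ← Finset.mul_prod_erase _ _ hy, mul_assoc]
  congr 1
  · simp [Function.update_of_ne h]
  congr 1
  · simp [Function.update_of_ne h.symm]
  · refine Finset.prod_congr rfl fun z hz => ?_
    rw [Finset.mem_erase, Finset.mem_erase] at hz
    simp [Function.update_of_ne hz.1, Function.update_of_ne hz.2.1]

theorem one_apply_eq_prod {x y : Λ} (h : x ≠ y) (σ τ : Λ → Fin 2) :
    (1 : Op Λ) σ τ = (1 : Matrix (Fin 2) (Fin 2) ℂ) (σ x) (τ x) *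
      (1 : Matrix (Fin 2) (Fin 2) ℂ) (σ y) (τ y) *
      ∏ z ∈ (Finset.univ.erase x).erase y, (1 : Matrix (Fin 2) (Fin 2) ℂ) (σ z) (τ z) := by
  have hy : y ∈ Finset.univ.erase x := Finset.mem_erase.2 ⟨h.symm, Finset.mem_univ y⟩
  rw [← tensorOp_one, tensorOp, of_apply,
    ← Finset.mul_prod_erase _ _ (Finset.mem_univ x), ← Finset.mul_prod_erase _ _ hy, mul_assoc]

theorem spin_zero_apply_nonneg (a b : Fin 2) : 0 ≤ spin 0 a b := by
  fin_cases a <;> fin_cases b <;> simp [spin, pauli]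

theorem spinAt_zero_apply_nonneg (x : Λ) (σ τ : Λ → Fin 2) : 0 ≤ spinAt 0 x σ τ := by
  rw [spinAt, siteOp_apply]
  exact mul_nonneg (spin_zero_apply_nonneg _ _) (prod_one_apply_nonneg _ _ _)

/-- The nonzero off-diagonal entries are `(1 ± u) / 4`, which is where `|u| ≤ 1` enters; the shift
`1 / 4` lifts the diagonal entries `± 1 / 4`. -/
theorem two_site_apply_nonneg {u : ℝ} (hu : u ∈ Set.Icc (-1 : ℝ) 1) (a b c d : Fin 2) :
    0 ≤ spin 0 a b * spin 0 c d + u * (spin 1 a b * spin 1 c d) + spin 2 a b * spin 2 c d +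
      (1 / 4 : ℂ) * ((1 : Matrix (Fin 2) (Fin 2) ℂ) a b * (1 : Matrix (Fin 2) (Fin 2) ℂ) c d) := by
  obtain ⟨h1, h2⟩ := hu
  rw [spin_zero_eq, spin_one_eq, spin_two_eq, Complex.le_def]
  fin_cases a <;> fin_cases b <;> fin_cases c <;> fin_cases d <;>
    norm_num <;> linarith

theorem bond_add_apply_nonneg {u : ℝ} (hu : u ∈ Set.Icc (-1 : ℝ) 1) {x y : Λ} (h : x ≠ y)
    (σ τ : Λ → Fin 2) : 0 ≤ (bond u x y + (1 / 4 : ℂ) • 1) σ τ := by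
  have := mul_nonneg (two_site_apply_nonneg hu (σ x) (τ x) (σ y) (τ y))
    (prod_one_apply_nonneg ((Finset.univ.erase x).erase y) σ τ)
  rw [bond, Matrix.add_apply, Matrix.add_apply, Matrix.add_apply, Matrix.smul_apply, Matrix.smul_apply, spinAt_mul_spinAt_apply h,
    spinAt_mul_spinAt_apply h, spinAt_mul_spinAt_apply h, one_apply_eq_prod h]
  simp only [smul_eq_mul]
  refine this.trans_eq ?_
  ring

theorem boltzmann_apply_nonneg {u β : ℝ} (hu : u ∈ Set.Icc (-1 : ℝ) 1) (hβ : 0 ≤ β)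
    (σ τ : Λ → Fin 2) : 0 ≤ boltzmann G u β σ τ := by
  refine exp_apply_nonneg_of_add_smul_one (2 * β * (G.edgeFinset.card * (1 / 4))) (fun σ τ => ?_) σ τ
  have : (-β : ℂ) • hamiltonian G u +
      ((2 * β * (G.edgeFinset.card * (1 / 4)) : ℝ) : ℂ) • (1 : Op Λ) =
      ((2 * β : ℝ) : ℂ) • ∑ e ∈ G.edgeFinset, (edgeBond u e + (1 / 4 : ℂ) • 1) := by
    rw [neg_smul_hamiltonian, Finset.sum_add_distrib, Finset.sum_const, smul_add,
      ← Nat.cast_smul_eq_nsmul ℂ, smul_smul, smul_smul]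
    push_cast
    congr 2
    ring
  rw [this, Matrix.smul_apply, Matrix.sum_apply]
  refine mul_nonneg (by exact_mod_cast (by positivity : (0 : ℝ) ≤ 2 * β))
    (Finset.sum_nonneg fun e he => ?_)
  induction e with
  | _ x y => exact bond_add_apply_nonneg hu (G.ne_of_adj (by simpa using he)) σ τ

/-- The Hadamard matrix; conjugation by it exchanges `S¹` and `S³`. -/
def hadamard : Matrix (Fin 2) (Fin 2) ℂ := !![1, 1; 1, -1]

/-- Leaving the matrix unnormalised avoids `√2`; its square is `2`. -/
theorem hadamard_mul_half : hadamard * ((1 / 2 : ℂ) • hadamard) = 1 := by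
  ext a b
  fin_cases a <;> fin_cases b <;> norm_num [hadamard, Matrix.mul_apply, Fin.sum_univ_two]

theorem half_mul_hadamard : ((1 / 2 : ℂ) • hadamard) * hadamard = 1 := by
  rw [smul_mul, ← Matrix.mul_smul, hadamard_mul_half]

/-- The product of the one-site Hadamard matrices. -/
def hadamardOp (Λ : Type*) [Fintype Λ] [DecidableEq Λ] : (Op Λ)ˣ where
  val := tensorOp fun _ => hadamard
  inv := tensorOp fun _ => (1 / 2 : ℂ) • hadamard
  val_inv := by rw [tensorOp_mul, hadamard_mul_half, tensorOp_one]
  inv_val := by rw [tensorOp_mul, half_mul_hadamard, tensorOp_one]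

theorem hadamardOp_conj_siteOp (x : Λ) (A : Matrix (Fin 2) (Fin 2) ℂ) :
    (hadamardOp Λ : Op Λ) * siteOp x A * ((hadamardOp Λ)⁻¹ : (Op Λ)ˣ) =
      siteOp x (hadamard * A * ((1 / 2 : ℂ) • hadamard)) := by
  change tensorOp (fun _ => hadamard) * siteOp x A * tensorOp (fun _ => (1 / 2 : ℂ) • hadamard) = _
  rw [siteOp, siteOp, tensorOp_mul, tensorOp_mul]
  congr 1
  funext z
  by_cases hz : z = x
  · subst hz; simp
  · rw [Function.update_of_ne hz, Function.update_of_ne hz, mul_one, hadamard_mul_half]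

theorem hadamardOp_conj_mul (X Y : Op Λ) :
    (hadamardOp Λ : Op Λ) * (X * Y) * ((hadamardOp Λ)⁻¹ : (Op Λ)ˣ) =
      (hadamardOp Λ : Op Λ) * X * ((hadamardOp Λ)⁻¹ : (Op Λ)ˣ) *
      ((hadamardOp Λ : Op Λ) * Y * ((hadamardOp Λ)⁻¹ : (Op Λ)ˣ)) := by
  simp [mul_assoc]

theorem hadamardOp_conj_spinAt_zero (x : Λ) :
    (hadamardOp Λ : Op Λ) * spinAt 0 x * ((hadamardOp Λ)⁻¹ : (Op Λ)ˣ) = spinAt 2 x := by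
  rw [spinAt, hadamardOp_conj_siteOp, spinAt]
  congr 1
  rw [spin_zero_eq, spin_two_eq, hadamard]
  ext a b
  fin_cases a <;> fin_cases b <;> norm_num

theorem hadamardOp_conj_spinAt_one (x : Λ) :
    (hadamardOp Λ : Op Λ) * spinAt 1 x * ((hadamardOp Λ)⁻¹ : (Op Λ)ˣ) = -spinAt 1 x := by
  rw [spinAt, hadamardOp_conj_siteOp, ← neg_one_smul ℂ (siteOp x _), ← siteOp_smul]
  congr 1
  rw [spin_one_eq, hadamard]
  ext a b
  fin_cases a <;> fin_cases b <;> norm_num <;> ring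

theorem hadamardOp_conj_spinAt_two (x : Λ) :
    (hadamardOp Λ : Op Λ) * spinAt 2 x * ((hadamardOp Λ)⁻¹ : (Op Λ)ˣ) = spinAt 0 x := by
  rw [spinAt, hadamardOp_conj_siteOp, spinAt]
  congr 1
  rw [spin_zero_eq, spin_two_eq, hadamard]
  ext a b
  fin_cases a <;> fin_cases b <;> norm_num

/-- The first and third terms are exchanged, and the sign of `S²` occurs twice. -/
theorem hadamardOp_conj_bond (u : ℝ) (x y : Λ) :
    (hadamardOp Λ : Op Λ) * bond u x y * ((hadamardOp Λ)⁻¹ : (Op Λ)ˣ) = bond u x y := by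
  rw [bond, mul_add, mul_add, add_mul, add_mul, Matrix.mul_smul, smul_mul, hadamardOp_conj_mul,
    hadamardOp_conj_mul, hadamardOp_conj_mul, hadamardOp_conj_spinAt_zero,
    hadamardOp_conj_spinAt_zero, hadamardOp_conj_spinAt_one, hadamardOp_conj_spinAt_one,
    hadamardOp_conj_spinAt_two, hadamardOp_conj_spinAt_two, neg_mul_neg]
  abel

theorem hadamardOp_conj_boltzmann (u β : ℝ) :
    (hadamardOp Λ : Op Λ) * boltzmann G u β * ((hadamardOp Λ)⁻¹ : (Op Λ)ˣ) = boltzmann G u β := by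
  rw [boltzmann, ← exp_units_conj, neg_smul_hamiltonian]
  congr 1
  rw [Matrix.mul_smul, smul_mul, Finset.mul_sum, Finset.sum_mul]
  congr 1
  refine Finset.sum_congr rfl fun e _ => ?_
  induction e with
  | _ x y => exact hadamardOp_conj_bond u x y

theorem trace_spinAt_two_mul_boltzmann (u β : ℝ) (x y : Λ) :
    (spinAt 2 x * spinAt 2 y * boltzmann G u β).trace =
      (spinAt 0 x * spinAt 0 y * boltzmann G u β).trace := by
  have : spinAt 2 x * spinAt 2 y * boltzmann G u β = (hadamardOp Λ : Op Λ) *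
      (spinAt 0 x * spinAt 0 y * boltzmann G u β) * ((hadamardOp Λ)⁻¹ : (Op Λ)ˣ) := by
    rw [hadamardOp_conj_mul, hadamardOp_conj_mul, hadamardOp_conj_spinAt_zero,
      hadamardOp_conj_spinAt_zero, hadamardOp_conj_boltzmann]
  rw [this, trace_mul_comm, ← mul_assoc, Units.inv_mul, one_mul]

theorem partitionFunction_pos (u β : ℝ) : 0 < partitionFunction G u β :=
  (neg_smul_hamiltonian_isHermitian G u β).trace_exp_pos

theorem gibbs_spinAt_two_nonneg {u β : ℝ} (hu : u ∈ Set.Icc (-1 : ℝ) 1) (hβ : 0 ≤ β) (x y : Λ) :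
    0 ≤ gibbs G u β (spinAt 2 x * spinAt 2 y) := by
  rw [gibbs, trace_spinAt_two_mul_boltzmann]
  refine div_nonneg (Finset.sum_nonneg fun σ _ => ?_) (partitionFunction_pos G u β).le
  rw [diag_apply, mul_apply]
  refine Finset.sum_nonneg fun τ _ => mul_nonneg ?_ (boltzmann_apply_nonneg G hu hβ _ _)
  rw [mul_apply]
  exact Finset.sum_nonneg fun ρ _ =>
    mul_nonneg (spinAt_zero_apply_nonneg _ _ _) (spinAt_zero_apply_nonneg _ _ _)

/-! ### Local rotations around the second axis -/

/-- The generator `∑ θ_z S²_z` of a position-dependent rotation. -/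
def twist (θ : Λ → ℝ) : Op Λ := ∑ z, (θ z : ℂ) • spinAt 1 z

theorem twist_isHermitian (θ : Λ → ℝ) : (twist θ).IsHermitian := by
  rw [IsHermitian, twist, conjTranspose_sum]
  exact Finset.sum_congr rfl fun z _ => (spinAt_isHermitian 1 z).smul (Complex.conj_ofReal _)

/-- The commutator with `X`, as a linear map. -/
def ad (X : Op Λ) : Op Λ →ₗ[ℂ] Op Λ := LinearMap.mulLeft ℂ X - LinearMap.mulRight ℂ X

theorem ad_apply (X Y : Op Λ) : ad X Y = X * Y - Y * X := rfl

theorem ad_mul (X Y Z : Op Λ) : ad X (Y * Z) = ad X Y * Z + Y * ad X Z := by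
  simp only [ad_apply]
  noncomm_ring

theorem ad_twist_siteOp (θ : Λ → ℝ) (x : Λ) (A : Matrix (Fin 2) (Fin 2) ℂ) :
    ad (twist θ) (siteOp x A) = (θ x : ℂ) • siteOp x (spin 1 * A - A * spin 1) := by
  rw [ad_apply, twist, Finset.sum_mul, Finset.mul_sum, ← Finset.sum_sub_distrib,
    Finset.sum_eq_single x]
  · rw [smul_mul, Matrix.mul_smul, ← smul_sub, spinAt, siteOp_mul, siteOp_mul, siteOp_sub]
  · intro z _ hz
    rw [smul_mul, Matrix.mul_smul, spinAt, (siteOp_commute hz _ _).eq, sub_self]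
  · simp

theorem ad_twist_spinAt_zero (θ : Λ → ℝ) (x : Λ) :
    ad (twist θ) (spinAt 0 x) = (-Complex.I * θ x) • spinAt 2 x := by
  rw [spinAt, ad_twist_siteOp, commutator_spin_one_zero, siteOp_smul, smul_smul, mul_comm, spinAt]

theorem ad_twist_spinAt_one (θ : Λ → ℝ) (x : Λ) : ad (twist θ) (spinAt 1 x) = 0 := by
  rw [spinAt, ad_twist_siteOp, siteOp_sub, sub_self, smul_zero]

theorem ad_twist_spinAt_two (θ : Λ → ℝ) (x : Λ) :
    ad (twist θ) (spinAt 2 x) = (Complex.I * θ x) • spinAt 0 x := by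
  rw [spinAt, ad_twist_siteOp, commutator_spin_one_two, siteOp_smul, smul_smul, mul_comm, spinAt]

/-- The `u` term commutes with the generator. The rest is invariant under a common rotation of both
spins, so each commutator yields a factor `θ x - θ y`. -/
theorem ad_twist_ad_twist_bond (θ : Λ → ℝ) (u : ℝ) (x y : Λ) :
    ad (twist θ) (ad (twist θ) (bond u x y)) =
      (((θ x - θ y) ^ 2 : ℝ) : ℂ) • (spinAt 0 x * spinAt 0 y + spinAt 2 x * spinAt 2 y) := by
  simp only [bond, map_add, map_smul, ad_mul, ad_twist_spinAt_zero, ad_twist_spinAt_one,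
    ad_twist_spinAt_two, zero_mul, mul_zero, add_zero, smul_zero, smul_mul, Matrix.mul_smul,
    smul_smul, smul_add]
  have hI : Complex.I * Complex.I = -1 := Complex.I_mul_I
  match_scalars <;> linear_combination (-(θ x - θ y : ℂ) ^ 2) * hI

/-- The squared increment of `θ` along an edge. -/
def sqIncrement (θ : Λ → ℝ) : Sym2 Λ → ℝ :=
  Sym2.lift ⟨fun x y => (θ x - θ y) ^ 2, fun x y => by ring⟩

theorem four_smul_sq {x y : Λ} (h : x ≠ y) (i : Fin 3) :
    ((4 : ℂ) • (spinAt i x * spinAt i y)) * ((4 : ℂ) • (spinAt i x * spinAt i y)) = 1 := by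
  rw [smul_mul_smul, spinAt_mul_spinAt_mul_self h, smul_smul]
  norm_num

theorem trace_spinAt_mul_boltzmann_le (u β : ℝ) {x y : Λ} (h : x ≠ y) (i : Fin 3) :
    (spinAt i x * spinAt i y * boltzmann G u β).trace.re ≤ 1 / 4 * (partitionFunction G u β).re := by
  have hP : ((4 : ℂ) • (spinAt i x * spinAt i y)).IsHermitian :=
    (spinAt_mul_spinAt_isHermitian h i i).smul (by simp [IsSelfAdjoint])
  have := (neg_smul_hamiltonian_isHermitian G u β).trace_mul_exp_re_le hP (four_smul_sq h i)
  rw [smul_mul, trace_smul] at this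
  change ((4 : ℂ) • (spinAt i x * spinAt i y * boltzmann G u β).trace).re ≤
    (partitionFunction G u β).re at this
  simp at this
  linarith

theorem trace_ad_twist_ad_twist_le (θ : Λ → ℝ) (u : ℝ) {β : ℝ} (hβ : 0 ≤ β) :
    (ad (twist θ) (ad (twist θ) ((-β : ℂ) • hamiltonian G u)) * boltzmann G u β).trace.re ≤
      β * (∑ e ∈ G.edgeFinset, sqIncrement θ e) * (partitionFunction G u β).re := by
  have hedge : ∀ e ∈ G.edgeFinset, (ad (twist θ) (ad (twist θ) (edgeBond u e)) * boltzmann G u β).trace.re ≤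
      1 / 2 * sqIncrement θ e * (partitionFunction G u β).re := by
    intro e he
    induction e with
    | _ x y =>
      have hxy : x ≠ y := G.ne_of_adj (by simpa using he)
      change (ad (twist θ) (ad (twist θ) (bond u x y)) * boltzmann G u β).trace.re ≤
        1 / 2 * (θ x - θ y) ^ 2 * (partitionFunction G u β).re
      rw [ad_twist_ad_twist_bond, smul_mul, trace_smul, smul_eq_mul, Complex.re_ofReal_mul,
        add_mul, trace_add, Complex.add_re]
      have h0 := trace_spinAt_mul_boltzmann_le G u β hxy 0
      have h2 := trace_spinAt_mul_boltzmann_le G u β hxy 2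
      calc _ ≤ (θ x - θ y) ^ 2 * (1 / 4 * (partitionFunction G u β).re +
            1 / 4 * (partitionFunction G u β).re) := by gcongr
        _ = _ := by ring
  rw [neg_smul_hamiltonian, map_smul, map_smul, map_sum, map_sum, smul_mul, trace_smul, smul_eq_mul,
    Complex.re_ofReal_mul, Finset.sum_mul, trace_sum, Complex.re_sum]
  calc _ ≤ 2 * β * ∑ e ∈ G.edgeFinset, 1 / 2 * sqIncrement θ e * (partitionFunction G u β).re := by
        gcongr with e he
        exact hedge e he
    _ = _ := by
      rw [← Finset.sum_mul, ← Finset.mul_sum]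
      ring

/-- The correlation of two sites is controlled by the energy of any function interpolating between
`1` at the one and `0` at the other. -/
theorem sq_gibbs_spinAt_two_le (u : ℝ) {β : ℝ} (hβ : 0 ≤ β) {x y : Λ} (h : x ≠ y) (θ : Λ → ℝ)
    (hx : θ x = 1) (hy : θ y = 0) :
    ‖gibbs G u β (spinAt 2 x * spinAt 2 y)‖ ^ 2 ≤
      β / 16 * ∑ e ∈ G.edgeFinset, sqIncrement θ e := by
  have hH := neg_smul_hamiltonian_isHermitian G u β
  -- Since `θ y = 0`, only the spin at `x` is rotated, taking `S¹_x` to a multiple of `S³_x`; the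
  -- observable squares to `1 / 16`.
  have hb := hH.bogoliubov (twist θ) (spinAt 0 x * spinAt 2 y)
  have hcomm : twist θ * (spinAt 0 x * spinAt 2 y) - spinAt 0 x * spinAt 2 y * twist θ =
      (-Complex.I) • (spinAt 2 x * spinAt 2 y) := by
    rw [← ad_apply, ad_mul, ad_twist_spinAt_zero, ad_twist_spinAt_two, hx, hy]
    simp
  rw [hcomm, (spinAt_mul_spinAt_isHermitian h 0 2).eq, spinAt_mul_spinAt_mul_self h,
    (twist_isHermitian θ).eq, ← ad_apply, ← ad_apply, smul_mul, trace_smul, norm_smul,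
    norm_neg, Complex.norm_I, one_mul, ← add_smul, smul_mul, one_mul, trace_smul] at hb
  change ‖(spinAt 2 x * spinAt 2 y * boltzmann G u β).trace‖ ^ 2 ≤
    1 / 2 * ((1 / 16 + 1 / 16 : ℂ) • partitionFunction G u β).re *
    (ad (twist θ) (ad (twist θ) ((-β : ℂ) • hamiltonian G u)) * boltzmann G u β).trace.re at hb
  have hZ := partitionFunction_pos G u β
  have hZre : 0 < (partitionFunction G u β).re := (Complex.lt_def.1 hZ).1
  have hZeq : partitionFunction G u β = ((partitionFunction G u β).re : ℂ) :=
    Complex.ext rfl (Complex.lt_def.1 hZ).2.symm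
  have hd := trace_ad_twist_ad_twist_le G θ u hβ
  set Z := (partitionFunction G u β).re with hZdef
  have hsm : ((1 / 16 + 1 / 16 : ℂ) • partitionFunction G u β).re = 1 / 8 * Z := by
    rw [hZeq, smul_eq_mul]
    norm_num
  rw [hsm] at hb
  rw [gibbs, norm_div, div_pow, hZeq, Complex.norm_real, Real.norm_of_nonneg hZre.le,
    div_le_iff₀ (by positivity)]
  calc _ ≤ _ := hb
    _ ≤ 1 / 2 * (1 / 8 * Z) * (β * (∑ e ∈ G.edgeFinset, sqIncrement θ e) * Z) := by gcongr
    _ = _ := by ring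

end Heisenberg

end

noncomputable section

namespace Heisenberg

/-! ### A function of logarithmically small energy -/

/-- The radial profile `1 - log (1 + k) / log (1 + d)`, cut off at `0`. -/
def logProfile (d k : ℕ) : ℝ := max 0 (1 - Real.log (1 + k) / Real.log (1 + d))

theorem log_one_add_pos {d : ℕ} (hd : 1 ≤ d) : 0 < Real.log (1 + d) :=
  Real.log_pos (lt_add_of_pos_right 1 (Nat.cast_pos.2 hd))

theorem logProfile_zero (d : ℕ) : logProfile d 0 = 1 := by simp [logProfile]

theorem logProfile_eq_zero {d k : ℕ} (hd : 1 ≤ d) (h : d ≤ k) : logProfile d k = 0 := by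
  have hL := log_one_add_pos hd
  have hk : Real.log (1 + d) ≤ Real.log (1 + k) :=
    Real.log_le_log (by positivity) (by gcongr)
  rw [logProfile, max_eq_left]
  rw [sub_nonpos, one_le_div hL]
  exact hk

/-- Cutting off at `0` does not increase increments, and `log (1 + 1 / (k + 1)) ≤ 1 / (k + 1)`. -/
theorem sq_logProfile_sub_succ_le {d : ℕ} (hd : 1 ≤ d) (k : ℕ) :
    (logProfile d k - logProfile d (k + 1)) ^ 2 ≤ (1 / ((k + 1) * Real.log (1 + d))) ^ 2 := by
  have hL := log_one_add_pos hd
  refine sq_le_sq.2 ?_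
  have h1 : |logProfile d k - logProfile d (k + 1)| ≤
      |(Real.log (1 + (k + 1 : ℕ)) - Real.log (1 + k)) / Real.log (1 + d)| := by
    refine (abs_max_sub_max_le_max _ _ _ _).trans ?_
    rw [sub_zero, abs_zero, max_eq_right (abs_nonneg _)]
    refine le_of_eq (congrArg _ ?_)
    ring
  refine h1.trans ?_
  have h2 : Real.log (1 + k) ≤ Real.log (1 + (k + 1 : ℕ)) :=
    Real.log_le_log (by positivity) (by push_cast; linarith)
  have h3 : Real.log (1 + (k + 1 : ℕ)) - Real.log (1 + k) ≤ 1 / (k + 1) := by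
    rw [← Real.log_div (by positivity) (by positivity)]
    refine (Real.log_le_sub_one_of_pos (by positivity)).trans (le_of_eq ?_)
    push_cast
    field_simp
    ring
  rw [abs_of_nonneg (div_nonneg (sub_nonneg.2 h2) hL.le), abs_of_nonneg (by positivity),
    ← div_div]
  gcongr

/-- A bound for the squared increments of `logProfile d` at `k`. -/
def logProfileBound (d k : ℕ) : ℝ :=
  -- The inward increment, of order `1 / k`, dominates the outward one; `max k 1` covers the centre.
  -- Beyond `d` the profile vanishes at `k - 1` as well.
  if k ≤ d then (1 / ((max k 1 : ℕ) * Real.log (1 + d))) ^ 2 else 0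

theorem sq_logProfile_sub_le {d k l : ℕ} (hd : 1 ≤ d) (h : l = k ∨ l = k + 1 ∨ l = k - 1) :
    (logProfile d k - logProfile d l) ^ 2 ≤ logProfileBound d k := by
  have hL := log_one_add_pos hd
  rw [logProfileBound]
  split_ifs with hk
  · have hself : (logProfile d k - logProfile d k) ^ 2 ≤
        (1 / ((max k 1 : ℕ) * Real.log (1 + d))) ^ 2 := by
      rw [sub_self, zero_pow two_ne_zero]
      positivity
    have hm : (0 : ℝ) < (max k 1 : ℕ) := by exact_mod_cast Nat.lt_of_lt_of_le one_pos (le_max_right _ _)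
    rcases h with rfl | rfl | rfl
    · exact hself
    · refine (sq_logProfile_sub_succ_le hd k).trans ?_
      gcongr
      exact_mod_cast max_le (Nat.le_succ k) (Nat.le_add_left 1 k)
    · rcases Nat.eq_zero_or_pos k with rfl | hpos
      · exact hself
      · obtain ⟨j, rfl⟩ : ∃ j, k = j + 1 := ⟨k - 1, by omega⟩
        rw [Nat.add_sub_cancel, max_eq_left (Nat.le_add_left 1 j), ← neg_sub, neg_sq]
        exact_mod_cast sq_logProfile_sub_succ_le hd j
  · rw [logProfile_eq_zero hd (by omega), logProfile_eq_zero hd (by omega)]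
    simp

variable {Λ : Type*} [Fintype Λ] [DecidableEq Λ] (G : SimpleGraph Λ)

/-- Summing over spheres, the `C k` sites at distance `k` contribute at most `C / (k L ^ 2)`, a
harmonic sum; the centre gives the extra `1`. -/
theorem sum_logProfileBound_le {C : ℝ} (hG : G.Connected)
    (hC : ∀ (x : Λ) (k : ℕ), 1 ≤ k →
      ((Finset.univ.filter fun y => G.dist x y = k).card : ℝ) ≤ C * k) (hC0 : 0 ≤ C) (x : Λ) (d : ℕ) :
    ∑ z, logProfileBound d (G.dist x z) ≤
      (1 + C * (1 + Real.log d)) / Real.log (1 + d) ^ 2 := by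
  set L := Real.log (1 + d) with hL
  have hfib : ∑ z, logProfileBound d (G.dist x z) = ∑ k ∈ Finset.range (d + 1),
      ((Finset.univ.filter fun y => G.dist x y = k).card : ℝ) * (1 / ((max k 1 : ℕ) * L)) ^ 2 := by
    simp only [logProfileBound]
    rw [← Finset.sum_filter, ← Finset.sum_fiberwise_of_maps_to (g := fun z => G.dist x z)
      (t := Finset.range (d + 1)) (fun z hz => Finset.mem_range.2
        (Nat.lt_succ_of_le (Finset.mem_filter.1 hz).2))]
    refine Finset.sum_congr rfl fun k hk => ?_
    have hset : (Finset.univ.filter fun z => G.dist x z ≤ d).filter (fun z => G.dist x z = k) =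
        Finset.univ.filter fun y => G.dist x y = k := by
      ext z
      simp only [Finset.mem_filter, Finset.mem_univ, true_and, and_iff_right_iff_imp]
      intro h
      have := Finset.mem_range.1 hk
      omega
    rw [hset, ← nsmul_eq_mul]
    exact Finset.sum_eq_card_nsmul fun z hz => by rw [(Finset.mem_filter.1 hz).2]
  have h0 : (Finset.univ.filter fun y => G.dist x y = 0).card = 1 := by
    rw [Finset.card_eq_one]
    refine ⟨x, ?_⟩
    ext z
    simp [hG.dist_eq_zero_iff, eq_comm]
  rw [hfib, Finset.sum_range_succ', h0]
  have hterm : ∀ k ∈ Finset.range d,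
      ((Finset.univ.filter fun y => G.dist x y = k + 1).card : ℝ) *
        (1 / ((max (k + 1) 1 : ℕ) * L)) ^ 2 ≤ C / L ^ 2 * ((k : ℝ) + 1)⁻¹ := by
    intro k _
    rw [max_eq_left (Nat.le_add_left 1 k)]
    refine (mul_le_mul_of_nonneg_right (hC x (k + 1) (Nat.le_add_left 1 k))
      (sq_nonneg _)).trans (le_of_eq ?_)
    push_cast
    rw [div_pow, mul_pow]
    -- `d = 0` is not excluded, and then `L = 0`.
    rcases eq_or_ne L 0 with h | h
    · simp [h]
    · field_simp
  have hharm : ∑ k ∈ Finset.range d, ((k : ℝ) + 1)⁻¹ ≤ 1 + Real.log d := by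
    have := harmonic_le_one_add_log d
    rw [harmonic] at this
    push_cast at this
    exact this
  calc _ ≤ C / L ^ 2 * (1 + Real.log d) + 1 / L ^ 2 := by
        refine add_le_add ((Finset.sum_le_sum hterm).trans ?_) (le_of_eq (by simp))
        rw [← Finset.mul_sum]
        gcongr
    _ = _ := by ring

variable [DecidableRel G.Adj]

/-- Choosing an orientation embeds the edges into ordered pairs at distance `1`, a form to which the
sphere bound at radius `1` applies as a degree bound. -/
theorem sum_edgeFinset_le (f : Sym2 Λ → ℝ) (hf : ∀ e, 0 ≤ f e) :
    ∑ e ∈ G.edgeFinset, f e ≤ ∑ z, ∑ w with G.dist z w = 1, f s(z, w) := by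
  have hout : ∀ e : Sym2 Λ, s(e.out.1, e.out.2) = e := fun e => Quot.out_eq e
  have hinj : Function.Injective (fun e : Sym2 Λ => e.out) := fun e e' h => by
    have h' : e.out = e'.out := h
    rw [← hout e, ← hout e', h']
  calc ∑ e ∈ G.edgeFinset, f e = ∑ e ∈ G.edgeFinset, f s(e.out.1, e.out.2) :=
        Finset.sum_congr rfl fun e _ => by rw [hout]
    _ = ∑ p ∈ G.edgeFinset.image (fun e => e.out), f s(p.1, p.2) :=
        (Finset.sum_image (f := fun p : Λ × Λ => f s(p.1, p.2)) hinj.injOn).symm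
    _ ≤ ∑ p : Λ × Λ with G.dist p.1 p.2 = 1, f s(p.1, p.2) := by
        refine Finset.sum_le_sum_of_subset_of_nonneg (fun p hp => ?_) fun p _ _ => hf _
        obtain ⟨e, he, rfl⟩ := Finset.mem_image.1 hp
        rw [Finset.mem_filter, SimpleGraph.dist_eq_one_iff_adj, ← SimpleGraph.mem_edgeSet,
          hout, ← SimpleGraph.mem_edgeFinset]
        exact ⟨Finset.mem_univ _, he⟩
    _ = ∑ z, ∑ w with G.dist z w = 1, f s(z, w) := by
        simp only [Finset.sum_filter]
        exact Fintype.sum_prod_type _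

/-- In a graph of at most quadratic growth two points at distance `d` are separated by a function
of energy of order `1 / log d`. -/
theorem sum_sqIncrement_logProfile_le {C : ℝ} (hG : G.Connected)
    (hC : ∀ (x : Λ) (k : ℕ), 1 ≤ k →
      ((Finset.univ.filter fun y => G.dist x y = k).card : ℝ) ≤ C * k) (hC0 : 0 ≤ C) (x : Λ) {d : ℕ}
    (hd : 2 ≤ d) :
    ∑ e ∈ G.edgeFinset, sqIncrement (fun z => logProfile d (G.dist x z)) e ≤
      (2 * C + 3 * C ^ 2) / Real.log d := by
  have hd1 : 1 ≤ d := by omega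
  set θ : Λ → ℝ := fun z => logProfile d (G.dist x z) with hθ
  have hbound : ∀ k, 0 ≤ logProfileBound d k := fun k => by
    rw [logProfileBound]
    split_ifs <;> positivity
  have h1 : ∑ e ∈ G.edgeFinset, sqIncrement θ e ≤ C * ∑ z, logProfileBound d (G.dist x z) := by
    refine (sum_edgeFinset_le G _ fun e => ?_).trans ?_
    · induction e with
      | _ z w => exact sq_nonneg _
    rw [Finset.mul_sum]
    refine Finset.sum_le_sum fun z _ => ?_
    calc _ ≤ ∑ w with G.dist z w = 1, logProfileBound d (G.dist x z) := by
          refine Finset.sum_le_sum fun w hw => ?_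
          have hadj : G.Adj z w := SimpleGraph.dist_eq_one_iff_adj.1 (Finset.mem_filter.1 hw).2
          exact sq_logProfile_sub_le hd1 hadj.diff_dist_adj
      _ ≤ C * logProfileBound d (G.dist x z) := by
          rw [Finset.sum_const, nsmul_eq_mul]
          have := hC z 1 le_rfl
          rw [Nat.cast_one, mul_one] at this
          exact mul_le_mul_of_nonneg_right this (hbound _)
  have h2 := sum_logProfileBound_le G hG hC hC0 x d
  have hd' : (2 : ℝ) ≤ d := by exact_mod_cast hd
  -- This absorbs constants: `1 + C (1 + log d) ≤ (2 + 3 C) log d`.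
  have hl : 1 / 2 < Real.log d :=
    (by linarith [Real.log_two_gt_d9] : 1 / 2 < Real.log 2).trans_le
      (Real.log_le_log two_pos hd')
  have hlL : Real.log d ≤ Real.log (1 + d) := Real.log_le_log (by linarith) (by linarith)
  have hl0 : 0 < Real.log d := by linarith
  calc _ ≤ C * ((1 + C * (1 + Real.log d)) / Real.log (1 + d) ^ 2) :=
        h1.trans (mul_le_mul_of_nonneg_left h2 hC0)
    _ ≤ C * ((1 + C * (1 + Real.log d)) / Real.log d ^ 2) := by gcongr
    _ ≤ C * ((2 + 3 * C) * Real.log d / Real.log d ^ 2) := by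
        gcongr
        nlinarith
    _ = _ := by
        field_simp

end Heisenberg

end

/-- The constant `K` depends on `C` and `β` only. The Gibbs correlation is a complex number by
definition, so that it is real is part of the claim. The upper bound is stated for `d(x,y) ≥ 2`, as
its right-hand side is infinite otherwise. -/
theorem theorem3 (C β : ℝ) (hβ : 0 ≤ β) :
    ∃ K : ℝ, ∀ (Λ : Type*) [Fintype Λ] [DecidableEq Λ] (G : SimpleGraph Λ) [DecidableRel G.Adj],
      G.Connected →
      (∀ (x : Λ) (k : ℕ), 1 ≤ k →
        ((Finset.univ.filter fun y => G.dist x y = k).card : ℝ) ≤ C * k) →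
      ∀ u ∈ Set.Icc (-1 : ℝ) 1, ∀ x y : Λ,
        (Heisenberg.gibbs G u β (Heisenberg.spinAt 2 x * Heisenberg.spinAt 2 y)).im = 0 ∧
        0 ≤ (Heisenberg.gibbs G u β (Heisenberg.spinAt 2 x * Heisenberg.spinAt 2 y)).re ∧
        (2 ≤ G.dist x y →
          (Heisenberg.gibbs G u β (Heisenberg.spinAt 2 x * Heisenberg.spinAt 2 y)).re ≤
            K / √(Real.log (G.dist x y))) := by
  -- The Bogoliubov factor `β / 16` times the energy constant bounds the squared correlation, hence
  -- the root.
  refine ⟨√(β / 16 * (2 * C + 3 * C ^ 2)), fun Λ _ _ G _ hG hC u hu x y => ?_⟩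
  have hpos := Complex.le_def.1 (Heisenberg.gibbs_spinAt_two_nonneg G hu hβ x y)
  refine ⟨hpos.2.symm, hpos.1, fun hd => ?_⟩
  have hC0 : 0 ≤ C := by
    have h1 := hC x 1 le_rfl
    rw [Nat.cast_one, mul_one] at h1
    exact (Nat.cast_nonneg _).trans h1
  have hxy : x ≠ y := by
    rintro rfl
    simp at hd
  have hb := Heisenberg.sq_gibbs_spinAt_two_le G u hβ hxy
    (fun z => Heisenberg.logProfile (G.dist x y) (G.dist x z))
    (by simp [Heisenberg.logProfile_zero]) (Heisenberg.logProfile_eq_zero (by omega) le_rfl)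
  have hs := Heisenberg.sum_sqIncrement_logProfile_le G hG hC hC0 x hd
  refine (Complex.re_le_norm _).trans ?_
  rw [← Real.sqrt_div' _ (Real.log_natCast_nonneg _), mul_div_assoc]
  refine Real.le_sqrt_of_sq_le (hb.trans ?_)
  gcongr
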